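/- **Theorem (Diamond Lemma for monoidal categories).** Let $\Bbbk$ be a commutative ring, and let $\mathcal C$ be the $\Bbbk$-linear strict monoidal category presented by a set of generating objects, a set $\mathcal S$ of generating morphisms between words in the generating objects, and a family $\mathcal R$ of relations. Let $\bar X(n,m)$ be the set of string diagrams with source word $n$ and target word $m$ built from $\mathcal S$, up to rectilinear isotopy (that is, the morphisms $n\to m$ of the free strict monoidal category on the generators), and let $\bar X=\coprod_{n,m}\bar X(n,m)$; each relation is an element of some $\Bbbk\cdot\bar X(n,m)$ that is set equal to zero. Let $\le$ be a partial order on $\bar X$ which * respects morphism spaces: diagrams with different sources or different targets are incomparable; * is monoidal: if $B<B'$, then plugging $B$ and $B'$ into the same larger diagram gives diagrams $\phi<\psi$; * is compatible with $\mathcal R$: each relation $r\in\mathcal R$ can be rewritten, up to a unit of $\Bbbk$, as an equation $W_r=f_r$ with $W_r\in\bar X$ and $f_r$ a $\Bbbk$-linear combination of diagrams $A<W_r$; * satisfies the descending chain condition. Fix such equations $W_r=f_r$. For a diagram $A=C[W_r]$ obtained by plugging $W_r$ into a larger diagram $C$, the *elementary resolution* $\rho_{C,r}$ is the $\Bbbk$-linear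 map on the space $\Bbbk\cdot\bar X(n,m)$ with $A\in\bar X(n,m)$ that sends $C[W_r]$ to $C[f_r]$ and fixes every other diagram; a *resolution* is a finite (possibly empty) composition of elementary resolutions, and a diagram is *irreducible* if every resolution fixes it. An *ambiguity* is a diagram $A$ with two distinct occurrences $A=C[W_r]=D[W_s]$ of left hand sides (distinct subdiagrams, or $r\neq s$). It is *resolvable* if there are resolutions $\rho,\rho'$ with $\rho(C[f_r])=\rho'(D[f_s])$. It is *resolvable relative to $\le$* if $C[f_r]-D[f_s]$ lies in the $\Bbbk$-span $I_{<A}$ of all $E[W_t]-E[f_t]$ with $t\in\mathcal R$ and $E[W_t]<A$. Then the following are equivalent: 1. the irreducible diagrams form a basis of $\mathcal C$, i.e. for all $n,m$ the irreducible diagrams in $\bar X(n,m)$ represent a $\Bbbk$-basis of $\operatorname{Hom}_{\mathcal C}(n,m)$; 2. every ambiguity is resolvable; 3. every ambiguity is resolvable relative to $\le$. Suppose moreover that the set of all ambiguities is covered by classes ("types") $K_i$, $i\in T$, and that for each $i$ a set $M_i$ of ambiguities is given. * If each $M_i$ is a minimal set for type $K_i$ with respect to resolvability (if all ambiguities in $M_i$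 are resolvable, then so are all ambiguities in $K_i$), then 1–3 are equivalent to: all ambiguities in $\bigcup_i M_i$ are resolvable. * If each $M_i$ is a minimal set for type $K_i$ with respect to resolvability relative to $\le$ (if all ambiguities in $M_i$ are resolvable relative to $\le$, then so are all ambiguities in $K_i$), then 1–3 are equivalent to: all ambiguities in $\bigcup_i M_i$ are resolvable; and also to: all ambiguities in $\bigcup_i M_i$ are resolvable relative to $\le$. -/

import Mathlib

open CategoryTheory

universe u v w x t

/-- Generating objects and generating morphisms of a strict monoidal category. The source and the
target of a generating morphism are words in the generating objects. -/
structure MonSignature where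
  Obj : Type u
  Mor : Type v
  src : Mor → List Obj
  tgt : Mor → List Obj

namespace MonSignature

/-- One horizontal slice of a string diagram: a single generating morphism with
identity strands to its left and to its right. -/
structure Layer (S : MonSignature.{u, v}) where
  left : List S.Obj
  gen : S.Mor
  right : List S.Obj

variable {S : MonSignature.{u, v}}

namespace Layer

def source (l : S.Layer) : List S.Obj := l.left ++ S.src l.gen ++ l.right

def target (l : S.Layer) : List S.Obj := l.left ++ S.tgt l.gen ++ l.right

/-- Add identity strands on the left. -/
def whiskerLeft (a : List S.Obj) (l : S.Layer) : S.Layer := ⟨a ++ l.left, l.gen, l.right⟩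

/-- Add identity strands on the right. -/
def whiskerRight (b : List S.Obj) (l : S.Layer) : S.Layer := ⟨l.left, l.gen, l.right ++ b⟩

end Layer

/-- The layers `L`, stacked in this order, form a diagram with source `n` and target `m`. -/
def IsDiagram : List S.Obj → List S.Layer → List S.Obj → Prop
  | n, [], m => n = m
  | n, l :: L, m => n = l.source ∧ IsDiagram l.target L m

theorem isDiagram_append {n m p : List S.Obj} {L L' : List S.Layer}
    (h : IsDiagram n L m) (h' : IsDiagram m L' p) : IsDiagram n (L ++ L') p := by
  induction L generalizing n with
  | nil => cases h; exact h'
  | cons l L ih => exact ⟨h.1, ih h.2⟩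

theorem isDiagram_append_iff {n p : List S.Obj} {L L' : List S.Layer} :
    IsDiagram n (L ++ L') p ↔ ∃ m, IsDiagram n L m ∧ IsDiagram m L' p := by
  refine ⟨fun h => ?_, fun ⟨m, h, h'⟩ => isDiagram_append h h'⟩
  induction L generalizing n with
  | nil => exact ⟨n, rfl, h⟩
  | cons l L ih =>
    obtain ⟨m, h1, h2⟩ := ih h.2
    exact ⟨m, ⟨h.1, h1⟩, h2⟩

theorem isDiagram_whiskerLeft (a : List S.Obj) {n m : List S.Obj} {L : List S.Layer}
    (h : IsDiagram n L m) : IsDiagram (a ++ n) (L.map (Layer.whiskerLeft a)) (a ++ m) := by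
  induction L generalizing n with
  | nil => cases h; rfl
  | cons l L ih =>
    obtain ⟨rfl, h2⟩ := h
    refine ⟨by simp [Layer.source, Layer.whiskerLeft], ?_⟩
    have := ih h2
    simpa [Layer.target, Layer.whiskerLeft] using this

theorem isDiagram_whiskerRight (b : List S.Obj) {n m : List S.Obj} {L : List S.Layer}
    (h : IsDiagram n L m) : IsDiagram (n ++ b) (L.map (Layer.whiskerRight b)) (m ++ b) := by
  induction L generalizing n with
  | nil => cases h; rfl
  | cons l L ih =>
    obtain ⟨rfl, h2⟩ := h
    refine ⟨by simp [Layer.source, Layer.whiskerRight], ?_⟩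
    have := ih h2
    simpa [Layer.target, Layer.whiskerRight] using this

/-- String diagrams (in generic position, i.e. with the generating morphisms at different
heights) with source `n` and target `m`. -/
def Diagram (n m : List S.Obj) : Type (max u v) := {L : List S.Layer // IsDiagram n L m}

/-- The elementary rectilinear isotopy: two consecutive generating morphisms `s` and `t`, where `t`
lies to the right of `s` and is not connected to it, are slid past each other. -/
inductive Slide : List S.Layer → List S.Layer → Prop
  | mk (L L' : List S.Layer) (a b c : List S.Obj) (s t : S.Mor) :
    Slide (L ++ [⟨a, s, b ++ S.src t ++ c⟩, ⟨a ++ S.tgt s ++ b, t, c⟩] ++ L')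
      (L ++ [⟨a ++ S.src s ++ b, t, c⟩, ⟨a, s, b ++ S.tgt t ++ c⟩] ++ L')

theorem Slide.append_left (K : List S.Layer) {L L' : List S.Layer} (h : Slide L L') :
    Slide (K ++ L) (K ++ L') := by
  cases h with
  | mk M M' a b c s t => simpa using Slide.mk (K ++ M) M' a b c s t

theorem Slide.append_right (K : List S.Layer) {L L' : List S.Layer} (h : Slide L L') :
    Slide (L ++ K) (L' ++ K) := by
  cases h with
  | mk M M' a b c s t => simpa using Slide.mk M (M' ++ K) a b c s t

theorem Slide.whiskerLeft (w : List S.Obj) {L L' : List S.Layer} (h : Slide L L') :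
    Slide (L.map (Layer.whiskerLeft w)) (L'.map (Layer.whiskerLeft w)) := by
  cases h with
  | mk M M' a b c s t =>
    simpa [Layer.whiskerLeft] using
      Slide.mk (M.map (Layer.whiskerLeft w)) (M'.map (Layer.whiskerLeft w)) (w ++ a) b c s t

theorem Slide.whiskerRight (w : List S.Obj) {L L' : List S.Layer} (h : Slide L L') :
    Slide (L.map (Layer.whiskerRight w)) (L'.map (Layer.whiskerRight w)) := by
  cases h with
  | mk M M' a b c s t =>
    simpa [Layer.whiskerRight] using
      Slide.mk (M.map (Layer.whiskerRight w)) (M'.map (Layer.whiskerRight w)) a b (c ++ w) s t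

theorem Slide.isDiagram_iff {L L' : List S.Layer} (h : Slide L L') (n m : List S.Obj) :
    IsDiagram n L m ↔ IsDiagram n L' m := by
  cases h with
  | mk M M' a b c s t =>
    simp [isDiagram_append_iff, IsDiagram, Layer.source, Layer.target]

/-- Diagrams with source `n` and target `m` up to rectilinear isotopy (the equivalence relation
generated by slides). These are the morphisms of the free strict monoidal category. -/
def IsotopyClass (n m : List S.Obj) : Type (max u v) :=
  Quot (fun D E : Diagram n m => Slide D.1 E.1)

namespace IsotopyClass

variable {n m p q : List S.Obj}

def mk (D : Diagram n m) : IsotopyClass n m := Quot.mk _ D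

theorem mk_eq_of_eqvGen {L L' : List S.Layer} (h : Relation.EqvGen Slide L L')
    (hL : IsDiagram n L m) (hL' : IsDiagram n L' m) :
    mk (⟨L, hL⟩ : Diagram n m) = mk ⟨L', hL'⟩ := by
  have iff_of : ∀ {K K' : List S.Layer}, Relation.EqvGen Slide K K' →
      (IsDiagram n K m ↔ IsDiagram n K' m) := by
    intro K K' h
    induction h with
    | rel _ _ h => exact h.isDiagram_iff n m
    | refl => exact Iff.rfl
    | symm _ _ _ ih => exact ih.symm
    | trans _ _ _ _ _ ih1 ih2 => exact ih1.trans ih2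
  induction h with
  | rel _ _ h => exact Quot.sound h
  | refl => rfl
  | symm _ _ _ ih => exact (ih hL' hL).symm
  | trans _ _ _ h1 _ ih1 ih2 =>
    exact (ih1 hL ((iff_of h1).1 hL)).trans (ih2 _ hL')

/-- The identity diagram, with source and target written in two equal ways. -/
def ofEq (h : n = m) : IsotopyClass n m := mk ⟨[], h⟩

/-- Vertical composition, in diagrammatic order: `A` first (at the source side), then `B`. -/
def comp (A : IsotopyClass n m) (B : IsotopyClass m p) : IsotopyClass n p :=
  Quot.map₂ (fun (D : Diagram n m) (E : Diagram m p) =>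
      (⟨D.1 ++ E.1, isDiagram_append D.2 E.2⟩ : Diagram n p))
    (fun D _ _ h => h.append_left D.1) (fun _ _ E h => h.append_right E.1) A B

/-- Horizontal composition with the identity of the word `a` on the left. -/
def whiskerLeft (a : List S.Obj) (A : IsotopyClass n m) : IsotopyClass (a ++ n) (a ++ m) :=
  Quot.map (fun D : Diagram n m =>
      (⟨D.1.map (Layer.whiskerLeft a), isDiagram_whiskerLeft a D.2⟩ :
        Diagram (a ++ n) (a ++ m)))
    (fun _ _ h => h.whiskerLeft a) A

/-- Horizontal composition with the identity of the word `b` on the right. -/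
def whiskerRight (b : List S.Obj) (A : IsotopyClass n m) : IsotopyClass (n ++ b) (m ++ b) :=
  Quot.map (fun D : Diagram n m =>
      (⟨D.1.map (Layer.whiskerRight b), isDiagram_whiskerRight b D.2⟩ :
        Diagram (n ++ b) (m ++ b)))
    (fun _ _ h => h.whiskerRight b) A

/-! The laws of a strict monoidal category. -/

theorem id_comp (A : IsotopyClass n m) : comp (ofEq rfl) A = A := by
  induction A using Quot.ind
  rfl

theorem comp_id (A : IsotopyClass n m) : comp A (ofEq rfl) = A := by
  induction A using Quot.ind
  exact congrArg mk (Subtype.ext (List.append_nil _))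

theorem comp_assoc (A : IsotopyClass n m) (B : IsotopyClass m p) (C : IsotopyClass p q) :
    comp (comp A B) C = comp A (comp B C) := by
  induction A using Quot.ind
  induction B using Quot.ind
  induction C using Quot.ind
  exact congrArg mk (Subtype.ext (List.append_assoc _ _ _))

theorem ofEq_comp_ofEq (h : n = m) (h' : m = p) :
    comp (ofEq h) (ofEq h') = ofEq (h.trans h') := rfl

theorem whiskerLeft_ofEq (a : List S.Obj) (h : n = m) :
    whiskerLeft a (ofEq h) = ofEq (congrArg (a ++ ·) h) := rfl

theorem whiskerRight_ofEq (b : List S.Obj) (h : n = m) :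
    whiskerRight b (ofEq h) = ofEq (congrArg (· ++ b) h) := rfl

theorem whiskerLeft_comp (a : List S.Obj) (A : IsotopyClass n m) (B : IsotopyClass m p) :
    whiskerLeft a (comp A B) = comp (whiskerLeft a A) (whiskerLeft a B) := by
  induction A using Quot.ind
  induction B using Quot.ind
  exact congrArg mk (Subtype.ext List.map_append)

theorem whiskerRight_comp (b : List S.Obj) (A : IsotopyClass n m) (B : IsotopyClass m p) :
    whiskerRight b (comp A B) = comp (whiskerRight b A) (whiskerRight b B) := by
  induction A using Quot.ind
  induction B using Quot.ind
  exact congrArg mk (Subtype.ext List.map_append)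

theorem whiskerLeft_whiskerLeft (a b : List S.Obj) (A : IsotopyClass n m) :
    comp (whiskerLeft (a ++ b) A) (ofEq (List.append_assoc a b m)) =
      comp (ofEq (List.append_assoc a b n)) (whiskerLeft a (whiskerLeft b A)) := by
  induction A using Quot.ind
  refine congrArg mk (Subtype.ext ?_)
  simp [Layer.whiskerLeft, Function.comp_def]

theorem whiskerRight_whiskerRight (a b : List S.Obj) (A : IsotopyClass n m) :
    comp (whiskerRight b (whiskerRight a A)) (ofEq (List.append_assoc m a b)) =
      comp (ofEq (List.append_assoc n a b)) (whiskerRight (a ++ b) A) := by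
  induction A using Quot.ind
  refine congrArg mk (Subtype.ext ?_)
  simp [Layer.whiskerRight, Function.comp_def]

theorem whiskerRight_whiskerLeft (a b : List S.Obj) (A : IsotopyClass n m) :
    comp (whiskerRight b (whiskerLeft a A)) (ofEq (List.append_assoc a m b)) =
      comp (ofEq (List.append_assoc a n b)) (whiskerLeft a (whiskerRight b A)) := by
  induction A using Quot.ind
  refine congrArg mk (Subtype.ext ?_)
  simp [Layer.whiskerRight, Layer.whiskerLeft, Function.comp_def]

theorem whiskerLeft_nil (A : IsotopyClass n m) : whiskerLeft [] A = A := by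
  induction A using Quot.ind
  exact congrArg mk (Subtype.ext (List.map_id _))

theorem whiskerRight_nil (A : IsotopyClass n m) :
    comp (whiskerRight [] A) (ofEq (List.append_nil m)) =
      comp (ofEq (List.append_nil n)) A := by
  induction A using Quot.ind
  refine congrArg mk (Subtype.ext ?_)
  have : (Layer.whiskerRight [] : S.Layer → S.Layer) = id := by
    funext l
    simp [Layer.whiskerRight]
  simp [this]

theorem eqvGen_append_left (K : List S.Layer) {L L' : List S.Layer}
    (h : Relation.EqvGen Slide L L') : Relation.EqvGen Slide (K ++ L) (K ++ L') := by
  induction h with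
  | rel _ _ h => exact .rel _ _ (h.append_left K)
  | refl => exact .refl _
  | symm _ _ _ ih => exact .symm _ _ ih
  | trans _ _ _ _ _ ih1 ih2 => exact .trans _ _ _ ih1 ih2

theorem eqvGen_append_right (K : List S.Layer) {L L' : List S.Layer}
    (h : Relation.EqvGen Slide L L') : Relation.EqvGen Slide (L ++ K) (L' ++ K) := by
  induction h with
  | rel _ _ h => exact .rel _ _ (h.append_right K)
  | refl => exact .refl _
  | symm _ _ _ ih => exact .symm _ _ ih
  | trans _ _ _ _ _ ih1 ih2 => exact .trans _ _ _ ih1 ih2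

theorem eqvGen_layer {p q : List S.Obj} (l : S.Layer) (G : List S.Layer)
    (hG : IsDiagram p G q) :
    Relation.EqvGen Slide (l.whiskerRight p :: G.map (Layer.whiskerLeft l.target))
      (G.map (Layer.whiskerLeft l.source) ++ [l.whiskerRight q]) := by
  induction G generalizing p with
  | nil => cases hG; exact .refl _
  | cons g G ih =>
    obtain ⟨rfl, h2⟩ := hG
    have e := Slide.mk [] (G.map (Layer.whiskerLeft l.target)) l.left (l.right ++ g.left) g.right
      l.gen g.gen
    have e1 := eqvGen_append_left [g.whiskerLeft l.source] (ih h2)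
    refine .trans _ _ _ (.rel _ _ ?_) e1
    simpa [Layer.whiskerLeft, Layer.whiskerRight, Layer.source, Layer.target] using e

theorem eqvGen_exchange {n m p q : List S.Obj} (F G : List S.Layer)
    (hF : IsDiagram n F m) (hG : IsDiagram p G q) :
    Relation.EqvGen Slide
      (F.map (Layer.whiskerRight p) ++ G.map (Layer.whiskerLeft m))
      (G.map (Layer.whiskerLeft n) ++ F.map (Layer.whiskerRight q)) := by
  induction F generalizing n with
  | nil => cases hF; simpa using Relation.EqvGen.refl _
  | cons l F ih =>
    obtain ⟨rfl, h2⟩ := hF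
    have e1 := eqvGen_append_left [l.whiskerRight p] (ih h2)
    have e2 := eqvGen_append_right (F.map (Layer.whiskerRight q)) (eqvGen_layer l G hG)
    refine .trans _ _ _ (by simpa using e1) (by simpa using e2)

/-- The exchange law. -/
theorem exchange (A : IsotopyClass n m) (B : IsotopyClass p q) :
    comp (whiskerRight p A) (whiskerLeft m B) = comp (whiskerLeft n B) (whiskerRight q A) := by
  induction A using Quot.ind with | mk D => ?_
  induction B using Quot.ind with | mk E => ?_
  exact mk_eq_of_eqvGen (eqvGen_exchange D.1 E.1 D.2 E.2) _ _

/-- Plug the diagram `B` into a larger diagram: `B` gets identity strands `a` on its left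
and `b` on its right, and is then composed with `bot` (on the source side) and `top` (on the
target side). -/
def plug (a b : List S.Obj) (bot : IsotopyClass n (a ++ p ++ b)) (top : IsotopyClass (a ++ q ++ b) m)
    (B : IsotopyClass p q) : IsotopyClass n m :=
  comp bot (comp (whiskerRight b (whiskerLeft a B)) top)

end IsotopyClass

/-- The set of all isotopy classes of diagrams, with arbitrary source and target. -/
structure AnyClass (S : MonSignature.{u, v}) where
  src : List S.Obj
  tgt : List S.Obj
  cls : IsotopyClass src tgt

/-- An isotopy class of diagrams from `n` to `m` as a member of the set of all of them. -/
abbrev IsotopyClass.toAny {n m : List S.Obj} (A : IsotopyClass n m) : S.AnyClass := ⟨n, m, A⟩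

/-- The order respects morphism spaces: diagrams with different sources or targets are
incomparable. -/
def RespectsMorphismSpaces (S : MonSignature.{u, v}) [PartialOrder S.AnyClass] : Prop :=
  ∀ A B : S.AnyClass, A ≤ B → A.src = B.src ∧ A.tgt = B.tgt

/-- Monoidal partial order: plugging `B < B'` into the same larger diagram gives `φ < ψ`. -/
def IsMonoidalOrder (S : MonSignature.{u, v}) [PartialOrder S.AnyClass] : Prop :=
  ∀ {n m p q : List S.Obj} (a b : List S.Obj) (bot : IsotopyClass n (a ++ p ++ b))
    (top : IsotopyClass (a ++ q ++ b) m) (B B' : IsotopyClass p q),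
    B.toAny < B'.toAny →
      (IsotopyClass.plug a b bot top B).toAny < (IsotopyClass.plug a b bot top B').toAny

/-! Linear combinations of isotopy classes of diagrams. -/

section Linear

variable (k : Type w) [CommRing k]

/-- The free `k`-module on the isotopy classes of diagrams from `n` to `m`. -/
abbrev LinHom (n m : List S.Obj) : Type (max u v w) := IsotopyClass n m →₀ k

variable {n m p q : List S.Obj}

/-- Bilinear extension of vertical composition. -/
noncomputable def linComp : LinHom k n m →ₗ[k] LinHom k m p →ₗ[k] LinHom k n p :=
  Finsupp.linearCombination k (fun A => Finsupp.lmapDomain k k (IsotopyClass.comp A))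

/-- Linear extension of `A ↦ id_a ⊗ A`. -/
noncomputable def linWhiskerLeft (a : List S.Obj) : LinHom k n m →ₗ[k] LinHom k (a ++ n) (a ++ m) :=
  Finsupp.lmapDomain k k (IsotopyClass.whiskerLeft a)

/-- Linear extension of `A ↦ A ⊗ id_b`. -/
noncomputable def linWhiskerRight (b : List S.Obj) :
    LinHom k n m →ₗ[k] LinHom k (n ++ b) (m ++ b) :=
  Finsupp.lmapDomain k k (IsotopyClass.whiskerRight b)

/-- Plug a linear combination of diagrams into a larger diagram. -/
noncomputable def linPlug (a b : List S.Obj) (bot : IsotopyClass n (a ++ p ++ b))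
    (top : IsotopyClass (a ++ q ++ b) m) : LinHom k p q →ₗ[k] LinHom k n m :=
  Finsupp.lmapDomain k k (IsotopyClass.plug a b bot top)

end Linear

end MonSignature

open MonSignature

/-- A presentation of a `k`-linear strict monoidal category: generating objects and morphisms, and
a family of relations, each of which is a linear combination (to be set to zero) of isotopy classes
of diagrams with the same source and target. -/
structure MonPresentation (k : Type w) [CommRing k] where
  sig : MonSignature.{u, v}
  Rel : Type x
  relSrc : Rel → List sig.Obj
  relTgt : Rel → List sig.Obj
  rel : ∀ r, LinHom (S := sig) k (relSrc r) (relTgt r)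

namespace MonPresentation

variable {k : Type w} [CommRing k] (P : MonPresentation.{u, v, w, x} k)

/-- Membership in the monoidal ideal generated by the relations: the smallest family of
`k`-submodules that contains the relations and is closed under vertical composition with any
morphism and horizontal composition with identities. -/
inductive IsNull : ∀ {n m : List P.sig.Obj}, LinHom (S := P.sig) k n m → Prop
  | rel (r : P.Rel) : IsNull (P.rel r)
  | zero {n m : List P.sig.Obj} : IsNull (0 : LinHom (S := P.sig) k n m)
  | add {n m : List P.sig.Obj} {f g : LinHom (S := P.sig) k n m} :
      IsNull f → IsNull g → IsNull (f + g)
  | smul {n m : List P.sig.Obj} (c : k) {f : LinHom (S := P.sig) k n m} :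
      IsNull f → IsNull (c • f)
  | comp_right {n m p : List P.sig.Obj} {f : LinHom (S := P.sig) k n m}
      (g : LinHom (S := P.sig) k m p) : IsNull f → IsNull (linComp k f g)
  | comp_left {n m p : List P.sig.Obj} (f : LinHom (S := P.sig) k n m)
      {g : LinHom (S := P.sig) k m p} : IsNull g → IsNull (linComp k f g)
  | whiskerLeft {n m : List P.sig.Obj} (a : List P.sig.Obj) {f : LinHom (S := P.sig) k n m} :
      IsNull f → IsNull (linWhiskerLeft k a f)
  | whiskerRight {n m : List P.sig.Obj} (b : List P.sig.Obj) {f : LinHom (S := P.sig) k n m} :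
      IsNull f → IsNull (linWhiskerRight k b f)

/-- The part of the monoidal ideal generated by the relations that lies in the morphisms
from `n` to `m`. -/
def ideal (n m : List P.sig.Obj) : Submodule k (LinHom (S := P.sig) k n m) where
  carrier := {f | P.IsNull f}
  add_mem' := IsNull.add
  zero_mem' := IsNull.zero
  smul_mem' := fun c _ h => IsNull.smul c h

/-- Morphism spaces of the presented category: linear combinations of isotopy classes of
diagrams modulo the monoidal ideal generated by the relations. -/
abbrev Hom (n m : List P.sig.Obj) : Type (max u v w) :=
  LinHom (S := P.sig) k n m ⧸ P.ideal n m

namespace Hom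

variable {P} {n m p q : List P.sig.Obj}

/-- The morphism represented by a diagram. -/
noncomputable def of (A : IsotopyClass n m) : P.Hom n m :=
  (P.ideal n m).mkQ (Finsupp.single A 1)

/-- Composition of morphisms, in diagrammatic order. -/
noncomputable def comp : P.Hom n m →ₗ[k] P.Hom m p →ₗ[k] P.Hom n p :=
  ((linComp k).compr₂ (P.ideal n p).mkQ).liftQ₂ (P.ideal n m) (P.ideal m p)
    (fun _ hf => LinearMap.ext fun g =>
      (Submodule.Quotient.mk_eq_zero _).2 (IsNull.comp_right g hf))
    (fun _ hg => LinearMap.ext fun f =>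
      (Submodule.Quotient.mk_eq_zero _).2 (IsNull.comp_left f hg))

/-- Tensor product with the identity of the word `a` on the left. -/
noncomputable def whiskerLeft (a : List P.sig.Obj) : P.Hom n m →ₗ[k] P.Hom (a ++ n) (a ++ m) :=
  (P.ideal n m).mapQ _ (linWhiskerLeft k a) (fun _ hf => IsNull.whiskerLeft a hf)

/-- Tensor product with the identity of the word `b` on the right. -/
noncomputable def whiskerRight (b : List P.sig.Obj) : P.Hom n m →ₗ[k] P.Hom (n ++ b) (m ++ b) :=
  (P.ideal n m).mapQ _ (linWhiskerRight k b) (fun _ hf => IsNull.whiskerRight b hf)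

theorem comp_add (f : P.Hom n m) (g g' : P.Hom m p) :
    comp f (g + g') = comp f g + comp f g' := map_add _ _ _

theorem comp_smul (f : P.Hom n m) (c : k) (g : P.Hom m p) :
    comp f (c • g) = c • comp f g := map_smul _ _ _

theorem comp_of (A : IsotopyClass (S := P.sig) n m) (B : IsotopyClass m p) :
    comp (of A : P.Hom n m) (of B) = of (A.comp B) := by
  simp [comp, of, linComp, LinearMap.liftQ₂]

theorem whiskerLeft_of (a : List P.sig.Obj) (A : IsotopyClass (S := P.sig) n m) :
    whiskerLeft a (of A : P.Hom n m) = of (A.whiskerLeft a) := by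
  simp [whiskerLeft, of, linWhiskerLeft]

theorem whiskerRight_of (b : List P.sig.Obj) (A : IsotopyClass (S := P.sig) n m) :
    whiskerRight b (of A : P.Hom n m) = of (A.whiskerRight b) := by
  simp [whiskerRight, of, linWhiskerRight]

theorem ind {motive : P.Hom n m → Prop} (f : P.Hom n m)
    (of : ∀ A, motive (of A)) (zero : motive 0)
    (add : ∀ f g, motive f → motive g → motive (f + g))
    (smul : ∀ (c : k) f, motive f → motive (c • f)) : motive f := by
  obtain ⟨f, rfl⟩ := (P.ideal n m).mkQ_surjective f
  induction f using Finsupp.induction_linear with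
  | zero => simpa using zero
  | add f g hf hg => simpa using add _ _ hf hg
  | single A c =>
    have := smul c _ (of A)
    rwa [Hom.of, ← map_smul, Finsupp.smul_single_one] at this

theorem comp_assoc {f : P.Hom n m} {g : P.Hom m p} {h : P.Hom p q} :
    comp (comp f g) h = comp f (comp g h) := by
  induction f using ind with
  | zero => simp
  | add f f' hf hf' => simp [hf, hf']
  | smul c f hf => simp [hf]
  | of A =>
  induction g using ind with
  | zero => simp
  | add f f' hf hf' => simp [hf, hf']
  | smul c f hf => simp [hf]
  | of B =>
  induction h using ind with
  | zero => simp
  | add f f' hf hf' => simp [hf, hf']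
  | smul c f hf => simp [hf]
  | of C => simp [comp_of, IsotopyClass.comp_assoc]

theorem exchange (f : P.Hom n m) (g : P.Hom p q) :
    comp (whiskerRight p f) (whiskerLeft m g) = comp (whiskerLeft n g) (whiskerRight q f) := by
  induction f using ind with
  | zero => simp
  | add f f' hf hf' => simp [hf, hf']
  | smul c f hf => simp [hf]
  | of A =>
  induction g using ind with
  | zero => simp
  | add f f' hf hf' => simp [hf, hf']
  | smul c f hf => simp [hf]
  | of B => simp [comp_of, whiskerLeft_of, whiskerRight_of, IsotopyClass.exchange]

theorem id_comp (f : P.Hom n m) : comp (of (.ofEq rfl)) f = f := by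
  induction f using ind with
  | zero => simp
  | add f f' hf hf' => simp [hf, hf']
  | smul c f hf => simp [hf]
  | of A => simp [comp_of, IsotopyClass.id_comp]

theorem comp_id (f : P.Hom n m) : comp f (of (.ofEq rfl)) = f := by
  induction f using ind with
  | zero => simp
  | add f f' hf hf' => simp [hf, hf']
  | smul c f hf => simp [hf]
  | of A => simp [comp_of, IsotopyClass.comp_id]

theorem whiskerLeft_comp (a : List P.sig.Obj) (f : P.Hom n m) (g : P.Hom m p) :
    whiskerLeft a (comp f g) = comp (whiskerLeft a f) (whiskerLeft a g) := by
  induction f using ind with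
  | zero => simp
  | add f f' hf hf' => simp [hf, hf']
  | smul c f hf => simp [hf]
  | of A =>
  induction g using ind with
  | zero => simp
  | add f f' hf hf' => simp [hf, hf']
  | smul c f hf => simp [hf]
  | of B => simp [comp_of, whiskerLeft_of, IsotopyClass.whiskerLeft_comp]

theorem whiskerRight_comp (b : List P.sig.Obj) (f : P.Hom n m) (g : P.Hom m p) :
    whiskerRight b (comp f g) = comp (whiskerRight b f) (whiskerRight b g) := by
  induction f using ind with
  | zero => simp
  | add f f' hf hf' => simp [hf, hf']
  | smul c f hf => simp [hf]
  | of A =>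
  induction g using ind with
  | zero => simp
  | add f f' hf hf' => simp [hf, hf']
  | smul c f hf => simp [hf]
  | of B => simp [comp_of, whiskerRight_of, IsotopyClass.whiskerRight_comp]

theorem whiskerLeft_whiskerLeft (a b : List P.sig.Obj) (f : P.Hom n m) :
    comp (whiskerLeft (a ++ b) f) (of (.ofEq (List.append_assoc a b m))) =
      comp (of (.ofEq (List.append_assoc a b n))) (whiskerLeft a (whiskerLeft b f)) := by
  induction f using ind with
  | zero => simp
  | add f f' hf hf' => simp [hf, hf']
  | smul c f hf => simp [hf]
  | of A => simp [comp_of, whiskerLeft_of, IsotopyClass.whiskerLeft_whiskerLeft]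

theorem whiskerRight_whiskerRight (a b : List P.sig.Obj) (f : P.Hom n m) :
    comp (whiskerRight b (whiskerRight a f)) (of (.ofEq (List.append_assoc m a b))) =
      comp (of (.ofEq (List.append_assoc n a b))) (whiskerRight (a ++ b) f) := by
  induction f using ind with
  | zero => simp
  | add f f' hf hf' => simp [hf, hf']
  | smul c f hf => simp [hf]
  | of A => simp [comp_of, whiskerRight_of, IsotopyClass.whiskerRight_whiskerRight]

theorem whiskerRight_whiskerLeft (a b : List P.sig.Obj) (f : P.Hom n m) :
    comp (whiskerRight b (whiskerLeft a f)) (of (.ofEq (List.append_assoc a m b))) =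
      comp (of (.ofEq (List.append_assoc a n b))) (whiskerLeft a (whiskerRight b f)) := by
  induction f using ind with
  | zero => simp
  | add f f' hf hf' => simp [hf, hf']
  | smul c f hf => simp [hf]
  | of A =>
    simp [comp_of, whiskerLeft_of, whiskerRight_of, IsotopyClass.whiskerRight_whiskerLeft]

theorem whiskerLeft_nil (f : P.Hom n m) : whiskerLeft [] f = f := by
  induction f using ind with
  | zero => simp
  | add f f' hf hf' => simp only [map_add]; rw [hf, hf']
  | smul c f hf => simp only [map_smul]; rw [hf]
  | of A => rw [whiskerLeft_of, IsotopyClass.whiskerLeft_nil]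

theorem whiskerRight_nil (f : P.Hom n m) :
    comp (whiskerRight [] f) (of (.ofEq (List.append_nil m))) =
      comp (of (.ofEq (List.append_nil n))) f := by
  induction f using ind with
  | zero => simp
  | add f f' hf hf' => simp [hf, hf']
  | smul c f hf => simp [hf]
  | of A => simp [comp_of, whiskerRight_of, IsotopyClass.whiskerRight_nil]

/-- The tensor product of two morphisms. -/
noncomputable def tensor (f : P.Hom n m) (g : P.Hom p q) : P.Hom (n ++ p) (m ++ q) :=
  comp (whiskerRight p f) (whiskerLeft m g)

theorem id_tensor_id (n m : List P.sig.Obj) :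
    tensor (of (.ofEq (rfl : n = n)) : P.Hom n n) (of (.ofEq (rfl : m = m))) =
      of (.ofEq rfl) := by
  simp [tensor, whiskerRight_of, whiskerLeft_of, comp_of, IsotopyClass.whiskerLeft_ofEq,
    IsotopyClass.whiskerRight_ofEq, IsotopyClass.ofEq_comp_ofEq]

theorem tensor_comp_tensor {n' m' p' : List P.sig.Obj} (f₁ : P.Hom n m) (f₂ : P.Hom n' m')
    (g₁ : P.Hom m p) (g₂ : P.Hom m' p') :
    comp (tensor f₁ f₂) (tensor g₁ g₂) = tensor (comp f₁ g₁) (comp f₂ g₂) := by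
  simp only [tensor]
  rw [whiskerLeft_comp, whiskerRight_comp, comp_assoc, comp_assoc,
    ← comp_assoc (f := whiskerLeft _ _), ← exchange, comp_assoc]

theorem associator_naturality {n' m' n'' m'' : List P.sig.Obj} (f₁ : P.Hom n m)
    (f₂ : P.Hom n' m') (f₃ : P.Hom n'' m'') :
    comp (tensor (tensor f₁ f₂) f₃) (of (.ofEq (List.append_assoc m m' m''))) =
      comp (of (.ofEq (List.append_assoc n n' n''))) (tensor f₁ (tensor f₂ f₃)) := by
  simp only [tensor]
  rw [whiskerRight_comp, whiskerLeft_comp, comp_assoc, whiskerLeft_whiskerLeft, comp_assoc,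
    ← comp_assoc (f := whiskerRight _ (whiskerLeft _ _)), whiskerRight_whiskerLeft,
    comp_assoc, ← comp_assoc, whiskerRight_whiskerRight, comp_assoc]

theorem leftUnitor_naturality (f : P.Hom n m) :
    comp (whiskerLeft [] f) (of (.ofEq (List.nil_append m))) =
      comp (of (.ofEq (List.nil_append n))) f := by
  rw [whiskerLeft_nil]
  exact (comp_id f).trans (id_comp f).symm

theorem pentagon (a b c d : List P.sig.Obj) :
    comp (whiskerRight d (of (.ofEq (List.append_assoc a b c)) : P.Hom _ _))
      (comp (of (.ofEq (List.append_assoc a (b ++ c) d)))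
        (whiskerLeft a (of (.ofEq (List.append_assoc b c d))))) =
    comp (of (.ofEq (List.append_assoc (a ++ b) c d)))
      (of (.ofEq (List.append_assoc a b (c ++ d)))) := by
  simp only [whiskerRight_of, whiskerLeft_of, comp_of, IsotopyClass.whiskerLeft_ofEq,
    IsotopyClass.whiskerRight_ofEq, IsotopyClass.ofEq_comp_ofEq]

theorem triangle (a b : List P.sig.Obj) :
    comp (of (.ofEq (List.append_assoc a [] b)) : P.Hom _ _)
      (whiskerLeft a (of (.ofEq (List.nil_append b)))) =
    whiskerRight b (of (.ofEq (List.append_nil a))) := by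
  simp only [whiskerRight_of, whiskerLeft_of, comp_of, IsotopyClass.whiskerLeft_ofEq,
    IsotopyClass.whiskerRight_ofEq, IsotopyClass.ofEq_comp_ofEq]

end Hom

/-- The presented `k`-linear strict monoidal category; its objects are the words in the
generating objects. -/
structure Cat where
  word : List P.sig.Obj

namespace Cat

noncomputable instance : Category.{max u v w} P.Cat where
  Hom X Y := P.Hom X.word Y.word
  id _ := Hom.of (.ofEq rfl)
  comp f g := Hom.comp f g
  id_comp f := Hom.id_comp f
  comp_id f := Hom.comp_id f
  assoc _ _ _ := Hom.comp_assoc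

noncomputable instance : Preadditive P.Cat where
  homGroup X Y := inferInstanceAs (AddCommGroup (P.Hom X.word Y.word))
  add_comp _ _ _ f f' g := LinearMap.map_add₂ Hom.comp f f' g
  comp_add _ _ _ f g g' := Hom.comp_add f g g'

noncomputable instance : Linear k P.Cat where
  homModule X Y := inferInstanceAs (Module k (P.Hom X.word Y.word))
  smul_comp _ _ _ c f g := LinearMap.map_smul₂ Hom.comp c f g
  comp_smul _ _ _ f c g := Hom.comp_smul f c g

/-- The identity isomorphism between two equal words. -/
noncomputable def isoOfEq {X Y : P.Cat} (h : X.word = Y.word) : X ≅ Y where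
  hom := Hom.of (.ofEq h)
  inv := Hom.of (.ofEq h.symm)
  hom_inv_id := Hom.comp_of _ _
  inv_hom_id := Hom.comp_of _ _

/-- The tensor product of objects is the concatenation of words; it is strictly associative and
unital, and the coherence isomorphisms are identities. -/
noncomputable instance : MonoidalCategoryStruct P.Cat where
  tensorObj X Y := ⟨X.word ++ Y.word⟩
  tensorUnit := ⟨[]⟩
  whiskerLeft X _ _ f := Hom.whiskerLeft X.word f
  whiskerRight f Y := Hom.whiskerRight Y.word f
  associator X Y Z := isoOfEq P (List.append_assoc X.word Y.word Z.word)
  leftUnitor X := isoOfEq P (List.nil_append X.word)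
  rightUnitor X := isoOfEq P (List.append_nil X.word)

noncomputable instance : MonoidalCategory P.Cat where
  tensorHom_def _ _ := rfl
  id_tensorHom_id X Y := Hom.id_tensor_id X.word Y.word
  tensorHom_comp_tensorHom f₁ f₂ g₁ g₂ := Hom.tensor_comp_tensor f₁ f₂ g₁ g₂
  whiskerLeft_id _ _ := Hom.whiskerLeft_of _ _
  id_whiskerRight _ _ := Hom.whiskerRight_of _ _
  associator_naturality f₁ f₂ f₃ := Hom.associator_naturality f₁ f₂ f₃
  leftUnitor_naturality f := Hom.leftUnitor_naturality f
  rightUnitor_naturality f := Hom.whiskerRight_nil f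
  pentagon W X Y Z := Hom.pentagon W.word X.word Y.word Z.word
  triangle X Y := Hom.triangle X.word Y.word

instance : MonoidalPreadditive P.Cat where
  whiskerLeft_zero := map_zero (Hom.whiskerLeft _)
  zero_whiskerRight := map_zero (Hom.whiskerRight _)
  whiskerLeft_add f g := map_add (Hom.whiskerLeft _) f g
  add_whiskerRight f g := map_add (Hom.whiskerRight _) f g

instance : MonoidalLinear k P.Cat where
  whiskerLeft_smul _ _ _ c f := map_smul (Hom.whiskerLeft _) c f
  smul_whiskerRight c _ _ f _ := map_smul (Hom.whiskerRight _) c f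

end Cat

/-- The morphism of the presented category that is represented by a diagram. -/
noncomputable def diagramHom (X Y : P.Cat) (A : IsotopyClass X.word Y.word) : X ⟶ Y :=
  Hom.of (P := P) A

/-- A way of writing every relation as an equation `W r = f r` between a single diagram `W r`
and a linear combination `f r` of diagrams. -/
structure Rewriting where
  W : ∀ r, IsotopyClass (S := P.sig) (P.relSrc r) (P.relTgt r)
  f : ∀ r, LinHom (S := P.sig) k (P.relSrc r) (P.relTgt r)
  rel_eq : ∀ r, ∃ c : kˣ, P.rel r = c • (Finsupp.single (W r) 1 - f r)

namespace Rewriting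

variable {P} (R : P.Rewriting)

/-- The order is compatible with the relations, written as `W r = f r`: all diagrams that occur in
`f r` are smaller than `W r`. -/
def Compatible [PartialOrder P.sig.AnyClass] : Prop :=
  ∀ r, ∀ A ∈ (R.f r).support, A.toAny < (R.W r).toAny

/-- An occurrence of some `W r` as a subdiagram of a diagram from `n` to `m`: the relation `r` and
the larger diagram into which `W r` is plugged. -/
structure Occurrence (R : P.Rewriting) (n m : List P.sig.Obj) where
  r : P.Rel
  left : List P.sig.Obj
  right : List P.sig.Obj
  bot : IsotopyClass (S := P.sig) n (left ++ P.relSrc r ++ right)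
  top : IsotopyClass (S := P.sig) (left ++ P.relTgt r ++ right) m

variable {R} {n m : List P.sig.Obj}

namespace Occurrence

/-- The diagram in which the occurrence takes place. -/
def diagram (o : R.Occurrence n m) : IsotopyClass (S := P.sig) n m :=
  IsotopyClass.plug o.left o.right o.bot o.top (R.W o.r)

/-- The result of replacing the subdiagram `W r` by `f r`. -/
noncomputable def replaced (o : R.Occurrence n m) : LinHom (S := P.sig) k n m :=
  linPlug k o.left o.right o.bot o.top (R.f o.r)

open Classical in
/-- The elementary resolution: the linear map that sends `o.diagram` to `o.replaced` and
fixes every other diagram. -/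
noncomputable def resolution (o : R.Occurrence n m) :
    LinHom (S := P.sig) k n m →ₗ[k] LinHom (S := P.sig) k n m :=
  Finsupp.linearCombination k
    (fun A => if A = o.diagram then o.replaced else Finsupp.single A 1)

end Occurrence

variable (R)

/-- The resolutions: all finite compositions of elementary resolutions. -/
noncomputable def resolutions (n m : List P.sig.Obj) :
    Submonoid (Module.End k (LinHom (S := P.sig) k n m)) :=
  Submonoid.closure (Set.range (Occurrence.resolution (R := R)))

/-- A diagram is irreducible if it is fixed by every resolution. -/
def IsIrreducible (A : IsotopyClass (S := P.sig) n m) : Prop :=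
  ∀ ρ ∈ R.resolutions n m, ρ (Finsupp.single A 1) = Finsupp.single A 1

/-- The irreducible diagrams form a basis of the presented category, i.e. of each of its
morphism spaces. -/
def IrreduciblesFormBasis : Prop :=
  ∀ X Y : P.Cat, ∃ b : Module.Basis
      {A : IsotopyClass (S := P.sig) X.word Y.word // R.IsIrreducible A} k (X ⟶ Y),
    ∀ A, b A = P.diagramHom X Y A.1

/-- An ambiguity: two distinct occurrences of left hand sides of relations in the same
diagram. (Two occurrences that differ only by an isotopy of the surrounding diagram count as
distinct here; they have the same replacement, so such a pair is always resolvable.) -/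
structure Ambiguity where
  src : List P.sig.Obj
  tgt : List P.sig.Obj
  fst : R.Occurrence src tgt
  snd : R.Occurrence src tgt
  same : fst.diagram = snd.diagram
  ne : fst ≠ snd

variable {R}

/-- The ambiguity is (jointly) resolvable: the two elementary resolutions of the diagram can be
further resolved to the same linear combination of diagrams. -/
def Ambiguity.Resolvable (a : R.Ambiguity) : Prop :=
  ∃ ρ ∈ R.resolutions a.src a.tgt, ∃ ρ' ∈ R.resolutions a.src a.tgt,
    ρ (a.fst.resolution (Finsupp.single a.fst.diagram 1)) =
      ρ' (a.snd.resolution (Finsupp.single a.snd.diagram 1))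

variable (R) in
/-- The span of all `C[W r] - C[f r]`, where `C[W r]` is `W r` plugged into a larger
diagram `C` and `C[W r] < A`. -/
noncomputable def idealBelow [PartialOrder P.sig.AnyClass]
    (A : IsotopyClass (S := P.sig) n m) : Submodule k (LinHom (S := P.sig) k n m) :=
  Submodule.span k {x | ∃ o : R.Occurrence n m, o.diagram.toAny < A.toAny ∧
    x = Finsupp.single o.diagram 1 - o.replaced}

/-- The ambiguity is resolvable relative to the order. -/
def Ambiguity.RelResolvable [PartialOrder P.sig.AnyClass] (a : R.Ambiguity) : Prop :=
  a.fst.resolution (Finsupp.single a.fst.diagram 1) -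
    a.snd.resolution (Finsupp.single a.snd.diagram 1) ∈ R.idealBelow a.fst.diagram

/-- `M` is a minimal set of ambiguities for the ambiguities of type `K`, with respect to a notion
`good` of resolvability: if all members of `M` are good, then so is every ambiguity of
type `K`. -/
def IsMinimalSet (good : R.Ambiguity → Prop) (K M : Set R.Ambiguity) : Prop :=
  (∀ a ∈ M, good a) → ∀ a ∈ K, good a

end Rewriting

end MonPresentation

/-! Fix words `n` and `m`. All occurrences of left hand sides in diagrams from `n` to `m` form one
system of rewriting rules on the free module on these diagrams, and Bergman's argument applies to
it. The monoidal structure enters through two facts. A monoidal order makes every rule strictly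
decreasing (`Compatible.diagramLT_diagram`). Contexts absorb composition and whiskering, so the
ideal is just the linear span of the differences `C[W_r] - C[f_r]` (`ideal_eq_relations`). The basis
property then says that the span of the irreducibles is a complement of the span of the relations
(`exists_basis_iff_isCompl`).

Termination alone makes the two spans add up to everything (`codisjoint_irreducibles_relations`). If
they also meet in zero, the two sides of an ambiguity, fully reduced, are irreducible and congruent,
hence equal (`exists_joinable_of_disjoint`). Resolvability implies its relative form, since reducing
a combination of diagrams below `A` changes it only by relations below `A`
(`sub_mem_relationsOn_of_joinable`). Finally, relative resolvability forces a linear normal form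
map, built from arbitrary choices of rules, to kill every relation; as it fixes the irreducibles,
the intersection is zero (`disjoint_of_forall_sub_mem`). -/

/-- A system of rewriting rules on linear combinations of elements of `X`: the rule `o` replaces
the single element `lhs o` by the linear combination `rhs o`. -/
structure ReductionSystem (k : Type*) [CommRing k] (X : Type*) where
  Rule : Type*
  lhs : Rule → X
  rhs : Rule → X →₀ k

/-! ### Linear rewriting on a free module. -/

namespace ReductionSystem

open Finsupp

variable {k : Type*} [CommRing k] {X : Type*} (Q : ReductionSystem k X)

open Classical in
/-- The linear map that applies the rule `o` and fixes all elements of `X` but `Q.lhs o`. -/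
noncomputable def reduce (o : Q.Rule) : (X →₀ k) →ₗ[k] (X →₀ k) :=
  linearCombination k (fun A => if A = Q.lhs o then Q.rhs o else single A 1)

/-- All finite compositions of the maps `Q.reduce o`. -/
noncomputable def reductions : Submonoid (Module.End k (X →₀ k)) :=
  Submonoid.closure (Set.range Q.reduce)

/-- The elements on which no rule acts. -/
def irreducibles : Set X := {A | ∀ o, Q.lhs o = A → Q.rhs o = single A 1}

/-- The span of all differences of left and right hand sides. -/
noncomputable def relations : Submodule k (X →₀ k) :=
  Submodule.span k (Set.range fun o => single (Q.lhs o) 1 - Q.rhs o)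

/-- The span of those differences of left and right hand sides whose left hand side
satisfies `p`. -/
noncomputable def relationsOn (p : X → Prop) : Submodule k (X →₀ k) :=
  Submodule.span k {x | ∃ o, p (Q.lhs o) ∧ x = single (Q.lhs o) 1 - Q.rhs o}

variable {Q}

theorem reduce_single_lhs (o : Q.Rule) : Q.reduce o (single (Q.lhs o) 1) = Q.rhs o := by
  simp [reduce]

theorem reduce_single_of_ne {o : Q.Rule} {A : X} (h : A ≠ Q.lhs o) :
    Q.reduce o (single A 1) = single A 1 := by
  simp [reduce, h]

theorem reduce_single_of_mem {A : X} (h : A ∈ Q.irreducibles) (o : Q.Rule) :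
    Q.reduce o (single A 1) = single A 1 := by
  by_cases hA : A = Q.lhs o
  · subst hA
    rw [reduce_single_lhs, h o rfl]
  · exact reduce_single_of_ne hA

theorem mem_irreducibles_iff {A : X} :
    A ∈ Q.irreducibles ↔ ∀ ρ ∈ Q.reductions, ρ (single A 1) = single A 1 := by
  refine ⟨fun h ρ hρ => ?_, ?_⟩
  · induction hρ using Submonoid.closure_induction with
    | mem ρ hρ => obtain ⟨o, rfl⟩ := hρ; exact reduce_single_of_mem h o
    | one => rfl
    | mul ρ σ _ _ h1 h2 => rw [Module.End.mul_apply, h2, h1]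
  · rintro h o rfl
    rw [← reduce_single_lhs]
    exact h _ (Submonoid.subset_closure ⟨o, rfl⟩)

/-- A linear map that is the identity on a set of elements of `X` is the identity on their span. -/
theorem apply_eq_self_of_mem_supported {s : Set X} {φ : (X →₀ k) →ₗ[k] (X →₀ k)}
    (hφ : ∀ A ∈ s, φ (single A 1) = single A 1) {x : X →₀ k} (hx : x ∈ supported k k s) :
    φ x = x := by
  rw [supported_eq_span_single] at hx
  induction hx using Submodule.span_induction with
  | mem x hx => obtain ⟨A, hA, rfl⟩ := hx; exact hφ A hA
  | zero => exact map_zero φ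
  | add x y _ _ hx hy => rw [map_add, hx, hy]
  | smul c x _ hx => rw [map_smul, hx]

theorem reductions_apply_of_mem_supported {x : X →₀ k} (hx : x ∈ supported k k Q.irreducibles)
    {ρ : Module.End k (X →₀ k)} (hρ : ρ ∈ Q.reductions) : ρ x = x :=
  apply_eq_self_of_mem_supported (fun _ hA => mem_irreducibles_iff.1 hA ρ hρ) hx

/-- A composition of rules does nothing to `A` until the first factor whose left hand side is `A`;
what follows acts on that right hand side. -/
theorem reductions_single (A : X) {ρ : Module.End k (X →₀ k)} (hρ : ρ ∈ Q.reductions) :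
    ρ (single A 1) = single A 1 ∨
      ∃ o, Q.lhs o = A ∧ ∃ σ ∈ Q.reductions, ρ (single A 1) = σ (Q.rhs o) := by
  induction hρ using Submonoid.closure_induction with
  | mem ρ hρ =>
    obtain ⟨o, rfl⟩ := hρ
    by_cases hA : A = Q.lhs o
    · subst hA
      exact .inr ⟨o, rfl, 1, one_mem _, reduce_single_lhs o⟩
    · exact .inl (reduce_single_of_ne hA)
  | one => exact .inl rfl
  | mul ρ σ hρ hσ h1 h2 =>
    rcases h2 with h2 | ⟨o, ho, τ, hτ, h2⟩
    · rwa [Module.End.mul_apply, h2]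
    · exact .inr ⟨o, ho, ρ * τ, mul_mem hρ hτ, by rw [Module.End.mul_apply, h2]; rfl⟩

/-! ### Reducibility of linear combinations. -/

variable (Q) in
/-- However `x` has been reduced, the result can be reduced further to a linear combination of
irreducible elements. -/
def IsReducible (x : X →₀ k) : Prop :=
  ∀ ρ ∈ Q.reductions, ∃ σ ∈ Q.reductions, σ (ρ x) ∈ supported k k Q.irreducibles

/-- This is where the quantification over all earlier `ρ` is needed: the map that finishes `y` must
be found after `σ` has finished `x`. It leaves the finished part alone, because reductions fix
combinations of irreducibles. -/
theorem IsReducible.add {x y : X →₀ k} (hx : Q.IsReducible x) (hy : Q.IsReducible y) :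
    Q.IsReducible (x + y) := by
  intro ρ hρ
  obtain ⟨σ, hσ, h1⟩ := hx ρ hρ
  obtain ⟨τ, hτ, h2⟩ := hy (σ * ρ) (mul_mem hσ hρ)
  refine ⟨τ * σ, mul_mem hτ hσ, ?_⟩
  rw [map_add, map_add]
  refine add_mem ?_ h2
  rw [Module.End.mul_apply, reductions_apply_of_mem_supported h1 hτ]
  exact h1

theorem isReducible_of_support {x : X →₀ k} (hx : ∀ A ∈ x.support, Q.IsReducible (single A 1)) :
    Q.IsReducible x := by
  have h : x ∈ supported k k (x.support : Set X) := (mem_supported k x).2 subset_rfl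
  replace hx : ∀ A ∈ (x.support : Set X), Q.IsReducible (single A 1) := hx
  -- The set must no longer depend on `x` before inducting over its span.
  generalize (x.support : Set X) = s at h hx
  rw [supported_eq_span_single] at h
  induction h using Submodule.span_induction with
  | mem y hy => obtain ⟨A, hA, rfl⟩ := hy; exact hx A hA
  | zero => exact fun ρ _ => ⟨1, one_mem _, by simp⟩
  | add y z _ _ hy hz => exact hy.add hz
  | smul c y _ hy =>
    intro ρ hρ
    obtain ⟨σ, hσ, h⟩ := hy ρ hρ
    exact ⟨σ, hσ, by simpa using Submodule.smul_mem _ c h⟩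

theorem relationsOn_le (p : X → Prop) : Q.relationsOn p ≤ Q.relations :=
  Submodule.span_mono fun _ ⟨o, _, h⟩ => ⟨o, h.symm⟩

/-- A rule alters at most one basis element, by exactly its own relation, and only when that element
satisfies `p`. -/
theorem sub_reduce_mem {p : X → Prop} (o : Q.Rule) {x : X →₀ k}
    (hx : x ∈ supported k k {A | p A}) : x - Q.reduce o x ∈ Q.relationsOn p := by
  rw [supported_eq_span_single] at hx
  induction hx using Submodule.span_induction with
  | mem x hx =>
    obtain ⟨A, hA, rfl⟩ := hx
    by_cases h : A = Q.lhs o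
    · subst h
      exact Submodule.subset_span ⟨o, hA, by simp only [reduce_single_lhs]⟩
    · simp only [reduce_single_of_ne h, sub_self, zero_mem]
  | zero => simp
  | add x y _ _ hx hy => rw [map_add, add_sub_add_comm]; exact add_mem hx hy
  | smul c x _ hx => rw [map_smul, ← smul_sub]; exact Submodule.smul_mem _ c hx

/-! ### Rewriting that decreases along a relation. -/

section Order

variable {lt : X → X → Prop}

theorem reduce_mem_supported [IsTrans X lt]
    (hlt : ∀ o, ∀ B ∈ (Q.rhs o).support, lt B (Q.lhs o)) (o : Q.Rule)
    {A : X} {x : X →₀ k} (hx : x ∈ supported k k {B | lt B A}) :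
    Q.reduce o x ∈ supported k k {B | lt B A} := by
  rw [supported_eq_span_single] at hx
  induction hx using Submodule.span_induction with
  | mem x hx =>
    obtain ⟨B, hB, rfl⟩ := hx
    by_cases h : B = Q.lhs o
    · subst h
      simp only [reduce_single_lhs]
      exact (mem_supported k _).2 fun C hC => _root_.trans (hlt o C hC) hB
    · simp only [reduce_single_of_ne h]
      exact single_mem_supported k 1 hB
  | zero => simp
  | add x y _ _ hx hy => rw [map_add]; exact add_mem hx hy
  | smul c x _ hx => rw [map_smul]; exact Submodule.smul_mem _ c hx

/-- The two claims are proved together: the difference telescopes along the composition, and the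
bound on the later step is available only because the earlier one stays below `A`. -/
theorem reductions_apply_mem [IsTrans X lt]
    (hlt : ∀ o, ∀ B ∈ (Q.rhs o).support, lt B (Q.lhs o)) {A : X}
    {ρ : Module.End k (X →₀ k)} (hρ : ρ ∈ Q.reductions) {x : X →₀ k}
    (hx : x ∈ supported k k {B | lt B A}) :
    ρ x ∈ supported k k {B | lt B A} ∧ x - ρ x ∈ Q.relationsOn (lt · A) := by
  induction hρ using Submonoid.closure_induction generalizing x with
  | mem ρ hρ =>
    obtain ⟨o, rfl⟩ := hρ
    exact ⟨reduce_mem_supported hlt o hx, sub_reduce_mem o hx⟩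
  | one => simpa using hx
  | mul ρ σ _ _ h1 h2 =>
    have hσ := h2 hx
    have hρ := h1 hσ.1
    refine ⟨hρ.1, ?_⟩
    rw [Module.End.mul_apply, ← sub_add_sub_cancel]
    exact add_mem hσ.2 hρ.2

theorem sub_reductions_mem_relations (x : X →₀ k) {ρ : Module.End k (X →₀ k)}
    (hρ : ρ ∈ Q.reductions) : x - ρ x ∈ Q.relations := by
  -- The bounded statement for one rule is reused with the bound that always holds.
  have hx (x : X →₀ k) : x ∈ supported k k {B : X | True} :=
    (mem_supported k x).2 fun _ _ => trivial
  induction hρ using Submonoid.closure_induction generalizing x with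
  | mem ρ hρ =>
    obtain ⟨o, rfl⟩ := hρ
    exact relationsOn_le _ (sub_reduce_mem o (hx x))
  | one => simp
  | mul ρ σ _ _ h1 h2 =>
    rw [Module.End.mul_apply, ← sub_add_sub_cancel]
    exact add_mem (h2 x) (h1 (σ x))

theorem sub_mem_relationsOn_of_joinable [IsTrans X lt]
    (hlt : ∀ o, ∀ B ∈ (Q.rhs o).support, lt B (Q.lhs o)) {o o' : Q.Rule}
    (h : Q.lhs o = Q.lhs o') {ρ ρ' : Module.End k (X →₀ k)} (hρ : ρ ∈ Q.reductions)
    (hρ' : ρ' ∈ Q.reductions) (e : ρ (Q.rhs o) = ρ' (Q.rhs o')) :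
    Q.rhs o - Q.rhs o' ∈ Q.relationsOn (lt · (Q.lhs o)) := by
  have h1 := (reductions_apply_mem hlt hρ ((mem_supported k _).2 (hlt o))).2
  have h2 := (reductions_apply_mem hlt hρ' ((mem_supported k _).2 (hlt o'))).2
  -- Both right hand sides are now compared with the same reduced element, which cancels in the
  -- difference.
  rw [← h, ← e] at h2
  simpa using sub_mem h1 h2

/-- By well-founded induction, the right hand side of any rule acting on `A` is reducible. A prior
reduction of `A` either has already passed through such a right hand side or can be followed by one
more rule. -/
theorem isReducible (hlt : ∀ o, ∀ B ∈ (Q.rhs o).support, lt B (Q.lhs o))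
    (hwf : WellFounded lt) (x : X →₀ k) : Q.IsReducible x := by
  refine isReducible_of_support fun A hA => ?_
  clear hA
  induction A using hwf.induction with
  | _ A ih =>
  have key (o : Q.Rule) (ho : Q.lhs o = A) : Q.IsReducible (Q.rhs o) :=
    isReducible_of_support fun B hB => ih B (ho ▸ hlt o B hB)
  intro ρ hρ
  rcases reductions_single A hρ with h | ⟨o, ho, σ, hσ, h⟩
  · by_cases hA : A ∈ Q.irreducibles
    · exact ⟨1, one_mem _, by simpa [h] using single_mem_supported k 1 hA⟩
    · simp only [irreducibles, Set.mem_ofPred_eq, not_forall] at hA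
      obtain ⟨o, ho, -⟩ := hA
      obtain ⟨τ, hτ, ht⟩ := key o ho 1 (one_mem _)
      refine ⟨τ * Q.reduce o, mul_mem hτ (Submonoid.subset_closure ⟨o, rfl⟩), ?_⟩
      subst ho
      rwa [h, Module.End.mul_apply, reduce_single_lhs]
  · rw [h]
    exact key o ho σ hσ

/-- Both right hand sides are congruent to their common left hand side, hence so are their fully
reduced forms. These differ by an irreducible combination that is also a relation. -/
theorem exists_joinable_of_disjoint (hlt : ∀ o, ∀ B ∈ (Q.rhs o).support, lt B (Q.lhs o))
    (hwf : WellFounded lt) (hdisj : Disjoint (supported k k Q.irreducibles) Q.relations)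
    {o o' : Q.Rule} (h : Q.lhs o = Q.lhs o') :
    ∃ ρ ∈ Q.reductions, ∃ ρ' ∈ Q.reductions, ρ (Q.rhs o) = ρ' (Q.rhs o') := by
  obtain ⟨ρ, hρ, h1⟩ := isReducible hlt hwf (Q.rhs o) 1 (one_mem _)
  obtain ⟨ρ', hρ', h2⟩ := isReducible hlt hwf (Q.rhs o') 1 (one_mem _)
  refine ⟨ρ, hρ, ρ', hρ', sub_eq_zero.1 (Submodule.disjoint_def.1 hdisj _ (sub_mem h1 h2) ?_)⟩
  have e1 := sub_reductions_mem_relations (Q.rhs o) hρ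
  have e2 := sub_reductions_mem_relations (Q.rhs o') hρ'
  have e3 : single (Q.lhs o) 1 - Q.rhs o ∈ Q.relations := Submodule.subset_span ⟨o, rfl⟩
  have e4 : single (Q.lhs o') 1 - Q.rhs o' ∈ Q.relations := Submodule.subset_span ⟨o', rfl⟩
  -- The sums telescope to left hand side minus reduced form; the common left hand side then
  -- cancels.
  have := sub_mem (add_mem e4 e2) (add_mem e3 e1)
  rw [h] at this
  simpa using this

/-! ### Normal forms and the complement criterion. -/

open Classical in
variable (Q) in
/-- The normal form of an element of `X`, obtained by repeatedly applying chosen rules. -/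
noncomputable def normalForm (hwf : WellFounded lt) : X → (X →₀ k) :=
  hwf.fix fun A N =>
    if h : ∃ o, Q.lhs o = A ∧ A ∉ Q.irreducibles then
      (Q.rhs h.choose).sum fun B c => c • if hB : lt B A then N B hB else 0
    else single A 1

theorem normalForm_of_mem (hwf : WellFounded lt) {A : X} (hA : A ∈ Q.irreducibles) :
    Q.normalForm hwf A = single A 1 := by
  rw [normalForm, hwf.fix_eq, dif_neg fun ⟨_, _, h⟩ => h hA]

theorem normalForm_of_notMem (hlt : ∀ o, ∀ B ∈ (Q.rhs o).support, lt B (Q.lhs o))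
    (hwf : WellFounded lt) {A : X} (hA : A ∉ Q.irreducibles) :
    ∃ o, Q.lhs o = A ∧
      Q.normalForm hwf A = linearCombination k (Q.normalForm hwf) (Q.rhs o) := by
  have h : ∃ o, Q.lhs o = A ∧ A ∉ Q.irreducibles := by
    have h := hA
    simp only [irreducibles, Set.mem_ofPred_eq, not_forall] at h
    obtain ⟨o, ho, -⟩ := h
    exact ⟨o, ho, hA⟩
  refine ⟨h.choose, h.choose_spec.1, ?_⟩
  rw [normalForm, hwf.fix_eq, dif_pos h, linearCombination_apply]
  refine Finsupp.sum_congr fun B hB => ?_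
  -- The default value `0` in the recursion is never reached, since every term of the right hand
  -- side is smaller.
  rw [dif_pos]
  simpa only [h.choose_spec.1] using hlt _ B hB

/-- If the two results of applying different rules to the same element always agree modulo
smaller relations, then no nonzero combination of irreducible elements is a relation. -/
theorem disjoint_of_forall_sub_mem (hlt : ∀ o, ∀ B ∈ (Q.rhs o).support, lt B (Q.lhs o))
    (hwf : WellFounded lt) (H : ∀ o o', Q.lhs o = Q.lhs o' →
      Q.rhs o - Q.rhs o' ∈ Q.relationsOn (lt · (Q.lhs o))) :
    Disjoint (supported k k Q.irreducibles) Q.relations := by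
  set N := linearCombination k (Q.normalForm hwf) with hN
  -- The induction runs over left hand sides: `N` was defined from one chosen rule at each of them,
  -- and the claim is that all other rules agree with it.
  have key (A : X) : ∀ o, Q.lhs o = A → N (single (Q.lhs o) 1 - Q.rhs o) = 0 := by
    induction A using hwf.induction with
    | _ A ih =>
    rintro o rfl
    by_cases hA : Q.lhs o ∈ Q.irreducibles
    -- A rule can act on an irreducible only trivially; as rules decrease along a well-founded
    -- relation, this happens only over the zero ring.
    · rw [hA o rfl, sub_self, map_zero]
    · obtain ⟨o', ho', e⟩ := normalForm_of_notMem hlt hwf hA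
      have hle : Q.relationsOn (lt · (Q.lhs o)) ≤ LinearMap.ker N := by
        refine Submodule.span_le.2 ?_
        rintro _ ⟨t, ht, rfl⟩
        exact ih _ ht t rfl
      have h := hle (H o o' ho'.symm)
      -- Any rule `o` and the chosen rule `o'` have right hand sides that differ by smaller
      -- relations, already killed by `N`.
      rw [LinearMap.mem_ker, map_sub, sub_eq_zero] at h
      rw [map_sub, h, hN, linearCombination_single, one_smul, e, sub_self]
  refine Submodule.disjoint_def.2 fun x hx hx' => ?_
  have hle : Q.relations ≤ LinearMap.ker N := by
    refine Submodule.span_le.2 ?_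
    rintro _ ⟨o, rfl⟩
    exact key _ o rfl
  rw [← apply_eq_self_of_mem_supported (φ := N) (fun A hA => ?_) hx]
  · exact hle hx'
  · rw [hN, linearCombination_single, one_smul, normalForm_of_mem hwf hA]

/-- Every `x` is its reduced form plus a relation. Only termination is used, so spanning does not
depend on the ambiguities. -/
theorem codisjoint_irreducibles_relations
    (hlt : ∀ o, ∀ B ∈ (Q.rhs o).support, lt B (Q.lhs o)) (hwf : WellFounded lt) :
    Codisjoint (supported k k Q.irreducibles) Q.relations := by
  rw [codisjoint_iff, Submodule.eq_top_iff']
  intro x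
  obtain ⟨ρ, hρ, h⟩ := isReducible hlt hwf x 1 (one_mem _)
  rw [← add_sub_cancel (ρ x) x]
  exact Submodule.add_mem_sup h (sub_reductions_mem_relations x hρ)

end Order

/-- A set of elements of `X` represents a basis of a quotient of `X →₀ k` if and only if its span
is a complement of the kernel. -/
theorem exists_basis_iff_isCompl (s : Set X) (J : Submodule k (X →₀ k)) :
    (∃ b : Module.Basis s k ((X →₀ k) ⧸ J), ∀ A, b A = J.mkQ (single A.1 1)) ↔
      IsCompl (supported k k s) J := by
  have hker : linearCombination k (fun A => J.mkQ (single A 1)) = J.mkQ := by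
    ext A
    simp
  have hli : LinearIndependent k (fun A : s => J.mkQ (single A.1 1)) ↔
      Disjoint (supported k k s) J := by
    have := linearIndepOn_iff_disjoint (R := k) (v := fun A => J.mkQ (single A 1)) (s := s)
    rwa [hker, Submodule.ker_mkQ] at this
  have hspan : Submodule.span k (Set.range fun A : s => J.mkQ (single A.1 1)) = ⊤ ↔
      Codisjoint (supported k k s) J := by
    -- The preimage of the image of a submodule under `J.mkQ` is its sum with `J`, and preimages
    -- under a surjection determine submodules.
    rw [codisjoint_iff, supported_eq_span_single, ← J.ker_mkQ,
      ← Submodule.comap_map_eq, Submodule.map_span, Submodule.ker_mkQ]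
    rw [← Submodule.comap_top J.mkQ,
      (Submodule.comap_injective_of_surjective J.mkQ_surjective).eq_iff, Set.image_image,
      Set.image_eq_range]
  constructor
  · rintro ⟨b, hb⟩
    have hb' : (b : s → _) = fun A => J.mkQ (single A.1 1) := funext hb
    exact ⟨hli.1 (hb' ▸ b.linearIndependent), hspan.1 (hb' ▸ b.span_eq)⟩
  · intro h
    exact ⟨Module.Basis.mk (hli.2 h.1) (hspan.2 h.2).ge, fun A => by rw [Module.Basis.mk_apply]⟩

end ReductionSystem

/-! ### Contexts absorb composition and whiskering. -/

namespace MonSignature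

namespace IsotopyClass

variable {S : MonSignature.{u, v}} {n m p q l : List S.Obj}

theorem plug_comp (a b : List S.Obj) (bot : IsotopyClass n (a ++ p ++ b))
    (top : IsotopyClass (a ++ q ++ b) m) (B : IsotopyClass p q) (C : IsotopyClass m l) :
    (plug a b bot top B).comp C = plug a b bot (top.comp C) B := by
  simp only [plug, comp_assoc]

theorem comp_plug (a b : List S.Obj) (bot : IsotopyClass n (a ++ p ++ b))
    (top : IsotopyClass (a ++ q ++ b) m) (B : IsotopyClass p q) (C : IsotopyClass l n) :
    C.comp (plug a b bot top B) = plug a b (C.comp bot) top B := by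
  simp only [plug, comp_assoc]

/-- The extra strands join the left strands of the context. The `ofEq` factors only reassociate
words and contribute no layers, so the two sides agree as lists of layers, without any slide. -/
theorem whiskerLeft_plug (c a b : List S.Obj) (bot : IsotopyClass n (a ++ p ++ b))
    (top : IsotopyClass (a ++ q ++ b) m) (B : IsotopyClass p q) :
    (plug a b bot top B).whiskerLeft c =
      plug (c ++ a) b ((bot.whiskerLeft c).comp (ofEq (by simp)))
        ((ofEq (by simp)).comp (top.whiskerLeft c)) B := by
  induction bot using Quot.ind
  induction top using Quot.ind
  induction B using Quot.ind
  refine congrArg mk (Subtype.ext ?_)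
  simp [Layer.whiskerLeft, Layer.whiskerRight, Function.comp_def]

theorem whiskerRight_plug (c a b : List S.Obj) (bot : IsotopyClass n (a ++ p ++ b))
    (top : IsotopyClass (a ++ q ++ b) m) (B : IsotopyClass p q) :
    (plug a b bot top B).whiskerRight c =
      plug a (b ++ c) ((bot.whiskerRight c).comp (ofEq (by simp)))
        ((ofEq (by simp)).comp (top.whiskerRight c)) B := by
  induction bot using Quot.ind
  induction top using Quot.ind
  induction B using Quot.ind
  refine congrArg mk (Subtype.ext ?_)
  simp [Layer.whiskerLeft, Layer.whiskerRight, Function.comp_def]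

theorem plug_nil (B : IsotopyClass p q) :
    plug [] [] (ofEq (by simp)) (ofEq (by simp)) B = B := by
  induction B using Quot.ind
  refine congrArg mk (Subtype.ext ?_)
  simp [Layer.whiskerLeft, Layer.whiskerRight, Function.comp_def]

end IsotopyClass

end MonSignature

/-! ### The monoidal ideal as a span of plugged relations. -/

namespace MonPresentation

variable {k : Type w} [CommRing k] {P : MonPresentation.{u, v, w, x} k}

/-- Plugging is a composite of the four operations under which the ideal is closed. -/
theorem IsNull.linPlug {n m p q : List P.sig.Obj} {a b : List P.sig.Obj}
    (bot : IsotopyClass (S := P.sig) n (a ++ p ++ b))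
    (top : IsotopyClass (S := P.sig) (a ++ q ++ b) m) {f : LinHom (S := P.sig) k p q}
    (hf : P.IsNull f) : P.IsNull (linPlug k a b bot top f) := by
  have h : MonSignature.linPlug k a b bot top =
      (linComp k (Finsupp.single bot 1)) ∘ₗ ((linComp k).flip (Finsupp.single top 1)) ∘ₗ
        linWhiskerRight k b ∘ₗ linWhiskerLeft k a := by
    ext A : 2
    simp [MonSignature.linPlug, linComp, linWhiskerLeft, linWhiskerRight, IsotopyClass.plug]
  rw [h]
  exact .comp_left _ (.comp_right _ (.whiskerRight b (.whiskerLeft a hf)))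

namespace Rewriting

variable (R : P.Rewriting) {n m p : List P.sig.Obj}

/-- The rewriting rules given by all occurrences of left hand sides of relations in diagrams
from `n` to `m`. -/
noncomputable def reductionSystem (n m : List P.sig.Obj) :
    ReductionSystem k (IsotopyClass (S := P.sig) n m) where
  Rule := R.Occurrence n m
  lhs := Occurrence.diagram
  rhs := Occurrence.replaced

/-- Turns a statement about a rule into one about the linear map `linPlug`, which can be checked on
single diagrams. -/
theorem single_diagram_sub_replaced (o : R.Occurrence n m) :
    Finsupp.single o.diagram 1 - o.replaced =
      linPlug k o.left o.right o.bot o.top (Finsupp.single (R.W o.r) 1 - R.f o.r) := by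
  rw [map_sub]
  simp [Occurrence.diagram, Occurrence.replaced, linPlug]

theorem isNull_single_sub (r : P.Rel) : P.IsNull (Finsupp.single (R.W r) 1 - R.f r) := by
  obtain ⟨c, hc⟩ := R.rel_eq r
  have := IsNull.smul (↑c⁻¹ : k) (IsNull.rel r)
  rwa [hc, ← Units.smul_def, inv_smul_smul] at this

variable {R}

/-- A linear map that carries each diagram with an occurrence of a left hand side to a diagram with
the corresponding occurrence maps relations to relations. -/
theorem map_mem_relations {n' m' : List P.sig.Obj}
    (φ : LinHom (S := P.sig) k n m →ₗ[k] LinHom (S := P.sig) k n' m')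
    (hφ : ∀ o : R.Occurrence n m, ∃ o' : R.Occurrence n' m',
      φ (Finsupp.single o.diagram 1 - o.replaced) = Finsupp.single o'.diagram 1 - o'.replaced)
    {f : LinHom (S := P.sig) k n m} (hf : f ∈ (R.reductionSystem n m).relations) :
    φ f ∈ (R.reductionSystem n' m').relations := by
  suffices h : (R.reductionSystem n m).relations ≤
      Submodule.comap φ (R.reductionSystem n' m').relations from h hf
  refine Submodule.span_le.2 ?_
  rintro _ ⟨o, rfl⟩
  obtain ⟨o', ho'⟩ := hφ o
  exact Submodule.subset_span ⟨o', ho'.symm⟩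

theorem linComp_right_mem_relations {f : LinHom (S := P.sig) k n m}
    (g : LinHom (S := P.sig) k m p) (hf : f ∈ (R.reductionSystem n m).relations) :
    linComp k f g ∈ (R.reductionSystem n p).relations := by
  induction g using Finsupp.induction_linear with
  | zero => simp
  | add g g' h h' => rw [map_add]; exact add_mem h h'
  | single C c =>
    rw [← Finsupp.smul_single_one, map_smul]
    refine Submodule.smul_mem _ c ?_
    refine map_mem_relations ((linComp k).flip (Finsupp.single C 1)) (fun o => ?_) hf
    -- By linearity one diagram `C` is composed at the target side, and it becomes part of the upper
    -- half of the context.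
    refine ⟨⟨o.r, o.left, o.right, o.bot, o.top.comp C⟩, ?_⟩
    simp only [single_diagram_sub_replaced, ← LinearMap.comp_apply]
    congr 1
    ext A : 2
    simp [linPlug, linComp, IsotopyClass.plug_comp]

theorem linComp_left_mem_relations (f : LinHom (S := P.sig) k n m)
    {g : LinHom (S := P.sig) k m p} (hg : g ∈ (R.reductionSystem m p).relations) :
    linComp k f g ∈ (R.reductionSystem n p).relations := by
  induction f using Finsupp.induction_linear with
  | zero => simp
  | add f f' h h' => rw [LinearMap.map_add₂]; exact add_mem h h'
  | single C c =>
    rw [← Finsupp.smul_single_one, LinearMap.map_smul₂]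
    refine Submodule.smul_mem _ c ?_
    refine map_mem_relations (linComp k (Finsupp.single C 1)) (fun o => ?_) hg
    refine ⟨⟨o.r, o.left, o.right, C.comp o.bot, o.top⟩, ?_⟩
    simp only [single_diagram_sub_replaced, ← LinearMap.comp_apply]
    congr 1
    ext A : 2
    simp [linPlug, linComp, IsotopyClass.comp_plug]

theorem linWhiskerLeft_mem_relations (a : List P.sig.Obj) {f : LinHom (S := P.sig) k n m}
    (hf : f ∈ (R.reductionSystem n m).relations) :
    linWhiskerLeft k a f ∈ (R.reductionSystem (a ++ n) (a ++ m)).relations := by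
  refine map_mem_relations _ (fun o => ?_) hf
  refine ⟨⟨o.r, a ++ o.left, o.right, (o.bot.whiskerLeft a).comp (.ofEq (by simp)),
    (IsotopyClass.ofEq (by simp)).comp (o.top.whiskerLeft a)⟩, ?_⟩
  simp only [single_diagram_sub_replaced, ← LinearMap.comp_apply]
  congr 1
  ext A : 2
  simp [linPlug, linWhiskerLeft, IsotopyClass.whiskerLeft_plug]

theorem linWhiskerRight_mem_relations (b : List P.sig.Obj) {f : LinHom (S := P.sig) k n m}
    (hf : f ∈ (R.reductionSystem n m).relations) :
    linWhiskerRight k b f ∈ (R.reductionSystem (n ++ b) (m ++ b)).relations := by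
  refine map_mem_relations _ (fun o => ?_) hf
  refine ⟨⟨o.r, o.left, o.right ++ b, (o.bot.whiskerRight b).comp (.ofEq (by simp)),
    (IsotopyClass.ofEq (by simp)).comp (o.top.whiskerRight b)⟩, ?_⟩
  simp only [single_diagram_sub_replaced, ← LinearMap.comp_apply]
  congr 1
  ext A : 2
  simp [linPlug, linWhiskerRight, IsotopyClass.whiskerRight_plug]

theorem rel_mem_relations (r : P.Rel) :
    P.rel r ∈ (R.reductionSystem (P.relSrc r) (P.relTgt r)).relations := by
  obtain ⟨c, hc⟩ := R.rel_eq r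
  rw [hc, Units.smul_def]
  -- The relation is, up to a unit, the rule for the empty context.
  refine Submodule.smul_mem _ _ (Submodule.subset_span
    ⟨⟨r, [], [], .ofEq (by simp), .ofEq (by simp)⟩, ?_⟩)
  refine (single_diagram_sub_replaced R _).trans ?_
  have h : linPlug k [] [] (.ofEq (by simp)) (.ofEq (by simp)) =
      (LinearMap.id : LinHom (S := P.sig) k (P.relSrc r) (P.relTgt r) →ₗ[k] _) := by
    ext A : 2
    simp [linPlug, IsotopyClass.plug_nil]
  exact LinearMap.congr_fun h _

variable (R) in
-- The span of plugged relations contains the relations and is stable under all operations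
-- generating the ideal; conversely, plugging preserves the ideal.
theorem ideal_eq_relations (n m : List P.sig.Obj) :
    P.ideal n m = (R.reductionSystem n m).relations := by
  refine le_antisymm (fun f hf => ?_) (Submodule.span_le.2 ?_)
  · replace hf : P.IsNull f := hf
    induction hf with
    | rel r => exact rel_mem_relations r
    | zero => exact zero_mem _
    | add _ _ h h' => exact add_mem h h'
    | smul c _ h => exact Submodule.smul_mem _ c h
    | comp_right g _ h => exact linComp_right_mem_relations g h
    | comp_left f _ h => exact linComp_left_mem_relations f h
    | whiskerLeft a _ h => exact linWhiskerLeft_mem_relations a h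
    | whiskerRight b _ h => exact linWhiskerRight_mem_relations b h
  · rintro _ ⟨o, rfl⟩
    refine Eq.mpr (congrArg _ (single_diagram_sub_replaced R o)) ?_
    exact (R.isNull_single_sub o.r).linPlug o.bot o.top

/-- Resolutions and the reductions of `reductionSystem` are the same by definition, so the abstract
results apply to diagrams directly. -/
theorem setOf_isIrreducible (n m : List P.sig.Obj) :
    {A | R.IsIrreducible A} = (R.reductionSystem n m).irreducibles :=
  Set.ext fun _ => (ReductionSystem.mem_irreducibles_iff (Q := R.reductionSystem n m)).symm

theorem irreduciblesFormBasis_iff : R.IrreduciblesFormBasis ↔ ∀ n m : List P.sig.Obj,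
    IsCompl (Finsupp.supported k k (R.reductionSystem n m).irreducibles)
      (R.reductionSystem n m).relations := by
  simp only [← setOf_isIrreducible, ← ideal_eq_relations,
    ← ReductionSystem.exists_basis_iff_isCompl]
  exact ⟨fun h n m => h ⟨n⟩ ⟨m⟩, fun h X Y => h X.word Y.word⟩

theorem resolution_single_diagram (o : R.Occurrence n m) :
    o.resolution (Finsupp.single o.diagram 1) = o.replaced :=
  ReductionSystem.reduce_single_lhs (Q := R.reductionSystem n m) o

/-! ### The order on diagrams and the three implications. -/

/-- The order on diagrams from `n` to `m`. -/
def diagramLT [PartialOrder P.sig.AnyClass] (A B : IsotopyClass (S := P.sig) n m) : Prop :=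
  A.toAny < B.toAny

variable [PartialOrder P.sig.AnyClass]

instance : IsTrans (IsotopyClass (S := P.sig) n m) diagramLT :=
  ⟨fun _ _ _ => lt_trans⟩

theorem wellFounded_diagramLT [WellFoundedLT P.sig.AnyClass] :
    WellFounded (diagramLT (P := P) (n := n) (m := m)) :=
  InvImage.wf IsotopyClass.toAny wellFounded_lt

/-- Each diagram in the replacement is some `B` from `f r` plugged into the context, and monoidality
carries the inequality between `B` and `W r` through that context. -/
theorem Compatible.diagramLT_diagram (hcompat : R.Compatible) (hmon : P.sig.IsMonoidalOrder)
    (o : R.Occurrence n m) :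
    ∀ A ∈ o.replaced.support, diagramLT A o.diagram := by
  classical
  intro A hA
  obtain ⟨B, hB, rfl⟩ := Finset.mem_image.1 (Finsupp.mapDomain_support hA)
  exact hmon _ _ _ _ _ _ (hcompat o.r B hB)

theorem Ambiguity.Resolvable.relResolvable (hcompat : R.Compatible)
    (hmon : P.sig.IsMonoidalOrder) {a : R.Ambiguity} (h : a.Resolvable) : a.RelResolvable := by
  obtain ⟨ρ, hρ, ρ', hρ', e⟩ := h
  rw [resolution_single_diagram, resolution_single_diagram] at e
  rw [RelResolvable, resolution_single_diagram, resolution_single_diagram]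
  exact ReductionSystem.sub_mem_relationsOn_of_joinable (Q := R.reductionSystem a.src a.tgt)
    (lt := diagramLT) (hcompat.diagramLT_diagram hmon) a.same hρ hρ' e

theorem IrreduciblesFormBasis.resolvable [WellFoundedLT P.sig.AnyClass]
    (hcompat : R.Compatible) (hmon : P.sig.IsMonoidalOrder) (h : R.IrreduciblesFormBasis)
    (a : R.Ambiguity) : a.Resolvable := by
  rw [Ambiguity.Resolvable, resolution_single_diagram, resolution_single_diagram]
  exact ReductionSystem.exists_joinable_of_disjoint (Q := R.reductionSystem a.src a.tgt)
    (lt := diagramLT) (hcompat.diagramLT_diagram hmon) wellFounded_diagramLT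
    (irreduciblesFormBasis_iff.1 h _ _).1 a.same

theorem irreduciblesFormBasis_of_relResolvable [WellFoundedLT P.sig.AnyClass]
    (hcompat : R.Compatible) (hmon : P.sig.IsMonoidalOrder)
    (h : ∀ a : R.Ambiguity, a.RelResolvable) : R.IrreduciblesFormBasis := by
  refine irreduciblesFormBasis_iff.2 fun n m => ?_
  have hlt := hcompat.diagramLT_diagram hmon (n := n) (m := m)
  refine ⟨ReductionSystem.disjoint_of_forall_sub_mem (Q := R.reductionSystem n m) hlt
    wellFounded_diagramLT fun o o' e => ?_,
    ReductionSystem.codisjoint_irreducibles_relations (Q := R.reductionSystem n m) hlt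
      wellFounded_diagramLT⟩
  -- An ambiguity requires distinct occurrences; equal ones contribute the zero difference.
  by_cases hne : o = o'
  · subst hne
    rw [sub_self]
    exact zero_mem _
  · have := h ⟨n, m, o, o', e, hne⟩
    rwa [Ambiguity.RelResolvable, resolution_single_diagram, resolution_single_diagram] at this

end Rewriting

end MonPresentation

/-- Diamond Lemma for monoidal categories. -/
theorem mainTheorem3 {k : Type w} [CommRing k] (P : MonPresentation.{u, v, w, x} k)
    [PartialOrder P.sig.AnyClass]
    (hspaces : P.sig.RespectsMorphismSpaces)
    (hmon : P.sig.IsMonoidalOrder)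
    (hdcc : WellFoundedLT P.sig.AnyClass)
    (R : P.Rewriting) (hcompat : R.Compatible) :
    [R.IrreduciblesFormBasis,
      ∀ a : R.Ambiguity, a.Resolvable,
      ∀ a : R.Ambiguity, a.RelResolvable].TFAE ∧
    (∀ (T : Type t) (K M : T → Set R.Ambiguity), (∀ a, ∃ i, a ∈ K i) →
      ((∀ i, MonPresentation.Rewriting.IsMinimalSet MonPresentation.Rewriting.Ambiguity.Resolvable (K i) (M i)) →
        (R.IrreduciblesFormBasis ↔ ∀ i, ∀ a ∈ M i, a.Resolvable)) ∧
      ((∀ i, MonPresentation.Rewriting.IsMinimalSet MonPresentation.Rewriting.Ambiguity.RelResolvable (K i) (M i)) →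
        [R.IrreduciblesFormBasis,
          ∀ i, ∀ a ∈ M i, a.Resolvable,
          ∀ i, ∀ a ∈ M i, a.RelResolvable].TFAE)) := by 
  have h12 := MonPresentation.Rewriting.IrreduciblesFormBasis.resolvable hcompat hmon
  have h23 : ∀ a : R.Ambiguity, a.Resolvable → a.RelResolvable :=
    fun _ h => h.relResolvable hcompat hmon
  have h31 := MonPresentation.Rewriting.irreduciblesFormBasis_of_relResolvable hcompat hmon
  refine ⟨?_, fun T K M hK => ⟨fun hM => ⟨fun h i a _ => h12 h a, fun h => ?_⟩, fun hM => ?_⟩⟩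
  · tfae_have 1 → 2 := h12
    tfae_have 2 → 3 := fun h a => h23 a (h a)
    tfae_have 3 → 1 := h31
    tfae_finish
  -- Minimality and the covering spread resolvability from the sets `M i` to all ambiguities.
  · refine h31 fun a => h23 a ?_
    obtain ⟨i, hi⟩ := hK a
    exact hM i (h i) a hi
  -- Relative minimality also serves the criterion by plain resolvability, because `h23` works one
  -- ambiguity at a time and so applies on the sets `M i` before spreading to the types.
  · tfae_have 1 → 2 := fun h i a _ => h12 h a
    tfae_have 2 → 3 := fun h i a ha => h23 a (h i a ha)
    tfae_have 3 → 1 := fun h => h31 fun a => by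
      obtain ⟨i, hi⟩ := hK a
      exact hM i (h i) a hi
    tfae_finish
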